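/- Let $n\ge 2$ and let $\Sigma_n$ be a disk with $n+1$ marked points $v_0,\dots,v_n$ on its boundary (in counterclockwise order), no punctures, and one orbifold point of order three in its interior. An arc is a curve joining marked points that has no self-intersections (its endpoints may coincide), meets the marked points only in its endpoints, avoids the orbifold point, is not isotopic to a boundary segment, and, if it cuts out a monogon, this monogon contains the orbifold point (then the arc is called pending); arcs are taken up to isotopy fixing the marked points and the orbifold point, and up to orientation. Two arcs are compatible if they have representatives that do not meet outside the marked points. A triangulation $\tau$ of $\Sigma_n$ is a maximal set of pairwise compatible arcs; it contains exactly one pending arc. The triangles of $\tau$ are the closures of the components of the complement in $\Sigma_n$ of the non-pending arcs of $\tau$; the component containing the orbifold point gives the orbifold triangle, a digon whose three sides are its two boundary sides and the pending arc inside it. A triangle is internal if none of its sides is a boundary segment. Let $Q(\tau)$ be the quiver whose vertices are the arcs of $\tau$, with an arrow $j\to i$ for each triangle $\Delta$ of $\tau$ and each pair of arcs $i,j$ that are sides of $\Delta$ such that $i$ directly succeeds $j$ in the clockwise orientation of $\Delta$, and with one further loop $\varepsilon$ at the pending arc. Let $S(\tau)=\sum_{\Delta} c_\Delta b_\Delta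 a_\Delta+\varepsilon^3$, where $\Delta$ runs over the internal triangles of $\tau$ and $c_\Delta b_\Delta a_\Delta$ is the 3-cycle of $Q(\tau)$ formed by the three arrows of $\Delta$. Let $\Lambda(\tau)=\mathcal P(Q(\tau),S(\tau))=\mathbb C\langle\langle Q(\tau)\rangle\rangle/J(Q(\tau),S(\tau))$ be the Jacobian algebra, where $\mathbb C\langle\langle Q\rangle\rangle$ is the completed path algebra and $J(Q,S)$ is the closure, in the topology given by the powers of the arrow ideal, of the two-sided ideal generated by all cyclic derivatives $\partial_a S$, $a\in Q_1$. Then $\Lambda(\tau)$ is a gentle algebra. That is, there is a set $P$ of paths of length two in $Q=Q(\tau)$ such that the inclusion $\mathbb C\langle Q\rangle\subseteq\mathbb C\langle\langle Q\rangle\rangle$ of the path algebra induces an isomorphism of $\mathbb C$-algebras $\mathbb C\langle Q\rangle/\langle P\rangle\cong\Lambda(\tau)$, and: (1) at every vertex of $Q$ at most two arrows start and at most two arrows end; (2) for every arrow $a$ there is at most one arrow $b$ such that $ab$ is a path not in $P$, and at most one arrow $c$ such that $ca$ is a path not in $P$; (3) the ideal $\langle P\rangle$ of $\mathbb C\langle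 Q\rangle$ is admissible, i.e. it is contained in the square of the arrow ideal and contains some power of the arrow ideal; (4) for every arrow $a$ there is at most one arrow $b$ such that $ab$ is a path in $P$, and at most one arrow $c$ such that $ca$ is a path in $P$. -/

import Mathlib

/-! ## Paths, the completed path algebra and the path algebra of a quiver

Quivers are Mathlib's: for `e : i ⟶ j` the tail of `e` is `i` and its head is `j`.
`Quiver.Path i j` is the type of paths that start at `i` and end at `j`. -/

namespace OrbPoly

open Quiver

/-- All paths of a quiver (including the trivial path at each vertex). -/
abbrev QPath (V : Type*) [Quiver V] := Σ i j : V, Path i j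

/-- The length of a path. -/
def QPath.len {V : Type*} [Quiver V] (p : QPath V) : ℕ := p.2.2.length

/-- All ways of cutting a path `p` into an initial part `q` and a final part `r`,
so that `p = q.comp r`; a path of length `m` has `m + 1` of them. -/
def splits {V : Type*} [Quiver V] {i : V} :
    {j : V} → Path i j → List (Σ k : V, Path i k × Path k j)
  | _, .nil => [⟨i, .nil, .nil⟩]
  | _, .cons p e =>
      ⟨_, .cons p e, .nil⟩ :: (splits p).map fun s => ⟨s.1, s.2.1, s.2.2.cons e⟩

/-- The completed path algebra `ℂ⟨⟨Q⟩⟩` of a quiver `Q` with finitely many vertices and arrows: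
a possibly infinite linear combination of paths is the family of its coefficients. -/
def CompletedPathAlgebra (V : Type*) [Quiver V] : Type _ := QPath V → ℂ

namespace CompletedPathAlgebra

variable {V : Type*} [Quiver V]

noncomputable instance : AddCommGroup (CompletedPathAlgebra V) :=
  inferInstanceAs (AddCommGroup (QPath V → ℂ))

noncomputable instance : Module ℂ (CompletedPathAlgebra V) :=
  inferInstanceAs (Module ℂ (QPath V → ℂ))

/-- The sum of the trivial paths. -/
noncomputable instance : One (CompletedPathAlgebra V) :=
  ⟨fun p => if p.len = 0 then 1 else 0⟩

/-- The product extends concatenation of paths. Paths are composed like maps: in `f * g` the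
factor `g` contributes the initial part of a path and `f` the final part. -/
noncomputable instance : Mul (CompletedPathAlgebra V) :=
  ⟨fun f g p => ((splits p.2.2).map fun s => f ⟨_, _, s.2.2⟩ * g ⟨_, _, s.2.1⟩).sum⟩

/-- The path `p` as an element of the completed path algebra. -/
noncomputable def ofPath (p : QPath V) : CompletedPathAlgebra V :=
  fun q => by classical exact if q = p then 1 else 0

@[ext]
theorem ext {f g : CompletedPathAlgebra V} (h : ∀ p, f p = g p) : f = g := funext h

@[simp] theorem add_apply (f g : CompletedPathAlgebra V) (p : QPath V) :
    (f + g) p = f p + g p := rfl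

@[simp] theorem neg_apply (f : CompletedPathAlgebra V) (p : QPath V) : (-f) p = -f p := rfl

@[simp] theorem zero_apply (p : QPath V) : (0 : CompletedPathAlgebra V) p = 0 := rfl

@[simp] theorem smul_apply (c : ℂ) (f : CompletedPathAlgebra V) (p : QPath V) :
    (c • f) p = c * f p := rfl

theorem one_apply (p : QPath V) :
    (1 : CompletedPathAlgebra V) p = if p.len = 0 then 1 else 0 := rfl

theorem mul_apply (f g : CompletedPathAlgebra V) (p : QPath V) :
    (f * g) p = ((splits p.2.2).map fun s => f ⟨_, _, s.2.2⟩ * g ⟨_, _, s.2.1⟩).sum := rfl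

end CompletedPathAlgebra

section splits

variable {V : Type*} [Quiver V]

theorem splits_comp {i j : V} (p : Path i j) : ∀ s ∈ splits p, s.2.1.comp s.2.2 = p := by
  induction p with
  | nil => simp [splits]
  | cons p e ih =>
    intro s hs
    simp only [splits, List.mem_cons, List.mem_map] at hs
    rcases hs with rfl | ⟨t, ht, rfl⟩
    · rfl
    · simp [ih t ht]

theorem splits_assoc {i j : V} (p : Path i j)
    (F : ∀ k l : V, Path i k → Path k l → Path l j → ℂ) :
    ((splits p).map fun s =>
      ((splits s.2.1).map fun t => F _ _ t.2.1 t.2.2 s.2.2).sum).sum =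
    ((splits p).map fun s =>
      ((splits s.2.2).map fun t => F _ _ s.2.1 t.2.1 t.2.2).sum).sum := by
  induction p with
  | nil => simp [splits]
  | cons p e ih =>
    have := ih fun k l a b c => F k l a b (c.cons e)
    simp only [splits, List.map_cons, List.map_map, List.sum_cons, Function.comp_def,
      List.sum_map_add, List.map_nil, List.sum_nil] at this ⊢
    rw [this]
    ring

end splits

namespace CompletedPathAlgebra

variable {V : Type*} [Quiver V]

theorem one_mul_aux {i j : V} (p : Path i j) (g : ∀ k : V, Path i k → ℂ) :
    ((splits p).map fun s => (if s.2.2.length = 0 then (1 : ℂ) else 0) * g _ s.2.1).sum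
      = g _ p := by
  cases p with
  | nil => simp [splits]
  | cons p e => simp [splits, Function.comp_def]

theorem mul_one_aux {i j : V} (p : Path i j) (g : ∀ k : V, Path k j → ℂ) :
    ((splits p).map fun s => g _ s.2.2 * (if s.2.1.length = 0 then (1 : ℂ) else 0)).sum
      = g _ p := by
  induction p with
  | nil => simp [splits]
  | cons p e ih => simpa [splits, Function.comp_def] using ih fun k r => g k (r.cons e)

noncomputable instance : Ring (CompletedPathAlgebra V) :=
  { (inferInstance : AddCommGroup (CompletedPathAlgebra V)),
    (inferInstance : One (CompletedPathAlgebra V)),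
    (inferInstance : Mul (CompletedPathAlgebra V)) with
    left_distrib := fun f g h => by
      ext p; simp [mul_apply, mul_add, List.sum_map_add]
    right_distrib := fun f g h => by
      ext p; simp [mul_apply, add_mul, List.sum_map_add]
    zero_mul := fun f => by ext p; simp [mul_apply]
    mul_zero := fun f => by ext p; simp [mul_apply]
    mul_assoc := fun f g h => by
      ext p
      have := splits_assoc p.2.2 fun k l a b c => f ⟨_, _, c⟩ * (g ⟨_, _, b⟩ * h ⟨_, _, a⟩)
      simp only [mul_apply, ← List.sum_map_mul_left, ← List.sum_map_mul_right, mul_assoc]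
      exact this.symm
    one_mul := fun f => by
      ext p
      exact one_mul_aux p.2.2 fun k q => f ⟨_, k, q⟩
    mul_one := fun f => by
      ext p
      exact mul_one_aux p.2.2 fun k q => f ⟨k, _, q⟩ }

noncomputable instance : Algebra ℂ (CompletedPathAlgebra V) :=
  Algebra.ofModule
    (fun c f g => by
      ext p; simp [mul_apply, mul_assoc, List.sum_map_mul_left])
    (fun c f g => by
      ext p; simp [mul_apply, mul_left_comm _ c, List.sum_map_mul_left])

/-- The `m`-th power `𝔐^m` of the ideal `𝔐` generated by the arrows: the combinations of
paths of length at least `m`. -/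
noncomputable def arrowIdealPow (V : Type*) [Quiver V] (m : ℕ) : TwoSidedIdeal (CompletedPathAlgebra V) :=
  TwoSidedIdeal.mk' {f | ∀ p : QPath V, p.len < m → f p = 0}
    (fun _ _ => rfl)
    (fun hx hy p hp => by simp [hx p hp, hy p hp])
    (fun hx p hp => by simp [hx p hp])
    (fun {x y} hy p hp => by
      rw [mul_apply]
      refine List.sum_eq_zero fun c hc => ?_
      obtain ⟨s, hs, rfl⟩ := List.mem_map.1 hc
      have h := congrArg Path.length (splits_comp _ s hs)
      rw [Path.length_comp] at h
      rw [hy ⟨_, _, s.2.1⟩ (by unfold QPath.len at hp ⊢; dsimp only; omega), mul_zero])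
    (fun {x y} hx p hp => by
      rw [mul_apply]
      refine List.sum_eq_zero fun c hc => ?_
      obtain ⟨s, hs, rfl⟩ := List.mem_map.1 hc
      have h := congrArg Path.length (splits_comp _ s hs)
      rw [Path.length_comp] at h
      rw [hx ⟨_, _, s.2.2⟩ (by unfold QPath.len at hp ⊢; dsimp only; omega), zero_mul])

/-- The closure `⋂ₘ (I + 𝔐^m)` of an ideal in the `𝔐`-adic topology. -/
noncomputable def closure (I : TwoSidedIdeal (CompletedPathAlgebra V)) :
    TwoSidedIdeal (CompletedPathAlgebra V) :=
  ⨅ m : ℕ, I ⊔ arrowIdealPow V m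

/-- The cyclic derivative of a potential `S` with respect to an arrow `a`. On a cycle it is
`∂ₐ(aₙ ⋯ a₁) = ∑ₖ δ_{a,aₖ} aₖ₋₁ ⋯ a₁ aₙ ⋯ aₖ₊₁`. Hence the coefficient of a path `p` in `∂ₐ S` is
the sum, over all ways of writing `p` as `u` followed by `v` with `u` starting at the head
and `v` ending at the tail of `a`, of the coefficient in `S` of the cycle that runs through `v`,
then `a`, then `u`. -/
noncomputable def cyclicDerivative {i j : V} (a : i ⟶ j) (S : CompletedPathAlgebra V) :
    CompletedPathAlgebra V := fun p => by
  classical exact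
    if h : p.1 = j ∧ p.2.1 = i then
      ((splits (p.2.2.cast h.1 h.2)).map fun s => S ⟨_, _, (s.2.2.cons a).comp s.2.1⟩).sum
    else 0

/-- The Jacobian ideal: the closure of the two-sided ideal generated by all cyclic
derivatives of the potential. -/
noncomputable def jacobianIdeal (S : CompletedPathAlgebra V) :
    TwoSidedIdeal (CompletedPathAlgebra V) :=
  closure (TwoSidedIdeal.span {f | ∃ (i j : V) (a : i ⟶ j), f = cyclicDerivative a S})

/-- The Jacobian algebra `𝒫(Q, S) = ℂ⟨⟨Q⟩⟩ / J(Q, S)`. -/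
abbrev JacobianAlgebra (S : CompletedPathAlgebra V) : Type _ := (jacobianIdeal S).ringCon.Quotient

end CompletedPathAlgebra

open CompletedPathAlgebra

/-- The path algebra `ℂ⟨Q⟩`: the finite linear combinations of paths. -/
noncomputable def PathAlgebra (V : Type*) [Quiver V] [Finite V] :
    Subalgebra ℂ (CompletedPathAlgebra V) where
  carrier := {f | {p : QPath V | f p ≠ 0}.Finite}
  mul_mem' := by
    intro f g hf hg
    refine Set.Finite.subset (hf.image2 (fun (a b : QPath V) => by
      classical exact if h : b.2.1 = a.1 then
        (⟨b.1, a.2.1, (b.2.2.cast rfl h).comp a.2.2⟩ : QPath V) else a) hg) ?_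
    rintro ⟨i, j, p⟩ hp
    rw [Set.mem_ofPred_eq, mul_apply] at hp
    obtain ⟨c, hc, hc0⟩ : ∃ c ∈ (splits p).map fun s =>
        f ⟨_, _, s.2.2⟩ * g ⟨_, _, s.2.1⟩, c ≠ 0 := by
      by_contra hcon
      push Not at hcon
      exact hp (List.sum_eq_zero hcon)
    obtain ⟨s, hs, rfl⟩ := List.mem_map.1 hc
    refine ⟨⟨_, _, s.2.2⟩, left_ne_zero_of_mul hc0, ⟨_, _, s.2.1⟩, right_ne_zero_of_mul hc0, ?_⟩
    simp [splits_comp p s hs]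
  add_mem' := by
    intro f g hf hg
    refine (hf.union hg).subset fun p hp => ?_
    by_contra hcon
    simp only [Set.mem_union, Set.mem_ofPred_eq, not_or, not_not] at hcon
    exact hp (by simp [hcon.1, hcon.2])
  algebraMap_mem' := by
    intro c
    refine (Set.finite_range fun i : V => (⟨i, i, .nil⟩ : QPath V)).subset ?_
    rintro ⟨i, j, p⟩ hp
    rw [Algebra.algebraMap_eq_smul_one, Set.mem_ofPred_eq, CompletedPathAlgebra.smul_apply, one_apply] at hp
    cases p with
    | nil => exact ⟨i, rfl⟩
    | cons p e => simp [QPath.len] at hp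

/-- The two-sided ideal `⟨P⟩` of the path algebra generated by a set `P` of paths. -/
noncomputable def pathIdeal {V : Type*} [Quiver V] [Finite V] (P : Set (QPath V)) :
    TwoSidedIdeal (PathAlgebra V) :=
  TwoSidedIdeal.span {x | ∃ p ∈ P, (x : CompletedPathAlgebra V) = ofPath p}

/-- The path `b a`: first the arrow `a`, then the arrow `b`. -/
def path₂ {V : Type*} [Quiver V] {i j k : V} (b : j ⟶ k) (a : i ⟶ j) : QPath V :=
  ⟨i, k, a.toPath.comp b.toPath⟩

/-- `ℂ⟨Q⟩ / ⟨P⟩` is a string algebra. -/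
structure IsString {V : Type*} [Quiver V] [Finite V] (P : Set (QPath V)) : Prop where
  /-- at most two arrows start at any vertex -/
  tail_le : ∀ i : V, ENat.card (Σ j : V, i ⟶ j) ≤ 2
  /-- at most two arrows end at any vertex -/
  head_le : ∀ i : V, ENat.card (Σ j : V, j ⟶ i) ≤ 2
  /-- for any arrow `a` there is at most one arrow `b` such that `a b` is a path not in `P` -/
  before_le : ∀ (i j : V) (a : i ⟶ j), {b : Σ k : V, k ⟶ i | path₂ a b.2 ∉ P}.encard ≤ 1
  /-- for any arrow `a` there is at most one arrow `c` such that `c a` is a path not in `P` -/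
  after_le : ∀ (i j : V) (a : i ⟶ j), {c : Σ k : V, j ⟶ k | path₂ c.2 a ∉ P}.encard ≤ 1
  /-- `⟨P⟩` is admissible: it lies in the square of the arrow ideal ... -/
  le_sq : ∀ x ∈ pathIdeal P, ∀ p : QPath V, p.len < 2 → (x : CompletedPathAlgebra V) p = 0
  /-- ... and contains some power of the arrow ideal -/
  pow_le : ∃ m : ℕ, ∀ x : PathAlgebra V,
    (∀ p : QPath V, p.len < m → (x : CompletedPathAlgebra V) p = 0) → x ∈ pathIdeal P

/-- `ℂ⟨Q⟩ / ⟨P⟩` is a gentle algebra. -/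
structure IsGentle {V : Type*} [Quiver V] [Finite V] (P : Set (QPath V)) : Prop
    extends IsString P where
  /-- the relations are paths of length two -/
  len_eq : ∀ p ∈ P, p.len = 2
  /-- for any arrow `a` there is at most one arrow `b` such that `a b` is a path in `P` -/
  before_mem_le : ∀ (i j : V) (a : i ⟶ j), {b : Σ k : V, k ⟶ i | path₂ a b.2 ∈ P}.encard ≤ 1
  /-- for any arrow `a` there is at most one arrow `c` such that `c a` is a path in `P` -/
  after_mem_le : ∀ (i j : V) (a : i ⟶ j), {c : Σ k : V, j ⟶ k | path₂ c.2 a ∈ P}.encard ≤ 1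

/-! ## The polygon with one orbifold point

`Σ_n` is a disk with `n + 1` marked points `v_0, …, v_n` on its boundary, in counterclockwise
order, and one orbifold point in its interior. Isotopies fix the orbifold point and arcs avoid it,
so arcs live in the annulus obtained by removing it. The universal cover of this annulus
is a half plane `ℝ × [0, ∞)`; the marked points lift to the integers on its boundary line, `a : ℤ`
lying over `v_{a mod n+1}`, the counterclockwise direction on the boundary of the disk being the
increasing one, and the deck transformations are the translations by multiples of `n + 1`.
A curve between marked points is determined up to homotopy by the two endpoints of a lift of it.
So a class of non-contractible unoriented curves is a pair `a < b` of integers up to simultaneous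
translation by multiples of `n + 1`. Two lifts have to cross if and only if their endpoints
interlace on the boundary line, and representatives (for instance geodesics) can be chosen that
have no crossings except those. -/

/-- The endpoints of two curves in the half plane interlace on its boundary line. -/
def Interlace (p q : ℤ × ℤ) : Prop :=
  (p.1 < q.1 ∧ q.1 < p.2 ∧ p.2 < q.2) ∨ (q.1 < p.1 ∧ p.1 < q.2 ∧ q.2 < p.2)

/-- The deck transformation: translation by `k (n + 1)`. -/
def translate (n : ℕ) (k : ℤ) (p : ℤ × ℤ) : ℤ × ℤ := (p.1 + k * (n + 1), p.2 + k * (n + 1))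

/-- An isotopy class of arcs of `Σ_n`, given by the endpoints `a < b` of its unique lift with
`0 ≤ a ≤ n`. It runs from `v_a` to `v_b` (indices mod `n + 1`) and is homotopic, in the complement
of the orbifold point, to the counterclockwise boundary path made of `b - a` boundary segments. -/
@[ext]
structure Arc (n : ℕ) where
  a : ℤ
  b : ℤ
  a_nonneg : 0 ≤ a
  a_le : a ≤ n
  /-- it is neither contractible nor isotopic to a boundary segment -/
  lt : a + 1 < b
  /-- it has no self-crossings -/
  simple : ∀ k : ℤ, ¬ Interlace (a, b) (translate n k (a, b))

/-- The pair `p` is a lift of the arc `α`. -/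
def Arc.IsLift {n : ℕ} (α : Arc n) (p : ℤ × ℤ) : Prop := ∃ k : ℤ, p = translate n k (α.a, α.b)

/-- Two arcs are compatible if they have representatives that do not meet outside the marked
points, that is, if no lift of one crosses a lift of the other. -/
def Arc.Compatible {n : ℕ} (α β : Arc n) : Prop :=
  ∀ p q : ℤ × ℤ, α.IsLift p → β.IsLift q → ¬ Interlace p q

/-- A pending arc: a loop around the orbifold point. -/
def Arc.IsPending {n : ℕ} (α : Arc n) : Prop := α.b = α.a + (n + 1)

/-- A triangulation of `Σ_n`: a maximal collection of pairwise compatible arcs. -/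
structure Triangulation (n : ℕ) where
  arcs : Set (Arc n)
  compatible : ∀ α ∈ arcs, ∀ β ∈ arcs, α.Compatible β
  maximal : ∀ γ : Arc n, (∀ α ∈ arcs, γ.Compatible α) → γ ∈ arcs

theorem Arc.b_le {n : ℕ} (α : Arc n) : α.b ≤ α.a + (n + 1) := by
  by_contra h
  refine α.simple 1 (Or.inl ⟨?_, ?_, ?_⟩) <;> simp only [translate] <;> omega

instance (n : ℕ) : Finite (Arc n) := by
  let f : Arc n → Set.Icc (0 : ℤ) n × Set.Icc (0 : ℤ) (2 * n + 1) := fun α =>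
    (⟨α.a, α.a_nonneg, α.a_le⟩, ⟨α.b, by have := α.a_nonneg; have := α.lt; omega,
      by have := α.a_le; have := α.b_le; omega⟩)
  refine Finite.of_injective f fun α β h => ?_
  simp only [f, Prod.mk.injEq] at h
  exact Arc.ext (congrArg Subtype.val h.1) (congrArg Subtype.val h.2)

namespace Triangulation

variable {n : ℕ} (τ : Triangulation n)

/-- The vertices of the quiver `Q(τ)` are the arcs of `τ`. -/
def Vertex : Type := {α : Arc n // α ∈ τ.arcs}

instance : Finite τ.Vertex := inferInstanceAs (Finite {α : Arc n // α ∈ τ.arcs})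

/-- A boundary segment or an arc of `τ`, given by (the endpoints of) a lift. -/
def IsSide (p : ℤ × ℤ) : Prop := p.2 = p.1 + 1 ∨ ∃ α ∈ τ.arcs, α.IsLift p

/-- A triangle of `τ`, given by the vertices `x < y < z` of its unique lift with `0 ≤ x ≤ n`.
If `z = x + n + 1` then the side from `x` to `z` is the pending arc, and this is the orbifold
triangle: the digon with vertices `v_x`, `v_y` that contains the pending arc at `v_x`.
Otherwise it is an ordinary triangle. -/
@[ext]
structure Triangle where
  x : ℤ
  y : ℤ
  z : ℤ
  x_nonneg : 0 ≤ x
  x_le : x ≤ n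
  x_lt : x < y
  y_lt : y < z
  side_xy : τ.IsSide (x, y)
  side_yz : τ.IsSide (y, z)
  side_xz : τ.IsSide (x, z)

/-- The sides of a triangle in clockwise order (`x`, `y`, `z` being in counterclockwise order). -/
def Triangle.side {τ : Triangulation n} (Δ : τ.Triangle) : Fin 3 → ℤ × ℤ :=
  ![(Δ.x, Δ.z), (Δ.y, Δ.z), (Δ.x, Δ.y)]

/-- The arrows of `Q(τ)`. -/
inductive Arrow : τ.Vertex → τ.Vertex → Type
  /-- In every triangle there is an arrow from `α` to `β` whenever the arcs `α`, `β` are sides of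
  the triangle and `β` succeeds `α` in the clockwise orientation. -/
  | inTriangle (Δ : τ.Triangle) (k : Fin 3) {α β : τ.Vertex}
      (hα : α.1.IsLift (Δ.side k)) (hβ : β.1.IsLift (Δ.side (k + 1))) : Arrow α β
  /-- There is a loop at the pending arc. -/
  | loop (α : τ.Vertex) (h : α.1.IsPending) : Arrow α α

/-- The quiver `Q(τ)`. -/
instance : Quiver τ.Vertex := ⟨τ.Arrow⟩

/-- An internal triangle: all of its sides are arcs of `τ`. -/
@[ext]
structure InternalTriangle extends τ.Triangle where
  arc : Fin 3 → τ.Vertex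
  isLift : ∀ k, (arc k).1.IsLift (toTriangle.side k)

/-- The arrow of an internal triangle from its `k`-th side to the next one. -/
def InternalTriangle.arrow {τ : Triangulation n} (Δ : τ.InternalTriangle) (k : Fin 3) :
    Δ.arc k ⟶ Δ.arc (k + 1) :=
  Arrow.inTriangle Δ.toTriangle k (Δ.isLift k) (Δ.isLift (k + 1))

/-- The 3-cycle of an internal triangle. -/
def InternalTriangle.cycle {τ : Triangulation n} (Δ : τ.InternalTriangle) : QPath τ.Vertex :=
  ⟨Δ.arc 0, Δ.arc 0, ((Path.nil.cons (Δ.arrow 0)).cons (Δ.arrow 1)).cons (Δ.arrow 2)⟩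

/-- The pending arcs of `τ` (in fact there is exactly one). -/
def PendingArc : Type := {α : τ.Vertex // α.1.IsPending}

/-- The loop `ε` at the pending arc. -/
def PendingArc.loop {τ : Triangulation n} (α : τ.PendingArc) : α.1 ⟶ α.1 := Arrow.loop α.1 α.2

/-- The path `ε³`. -/
def PendingArc.loopCubed {τ : Triangulation n} (α : τ.PendingArc) : QPath τ.Vertex :=
  ⟨α.1, α.1, ((Path.nil.cons α.loop).cons α.loop).cons α.loop⟩

instance : Finite τ.Triangle := by
  have hz : ∀ Δ : τ.Triangle, Δ.z ≤ Δ.x + (n + 1) := fun Δ => by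
    have h₁ := Δ.x_lt
    have h₂ := Δ.y_lt
    rcases Δ.side_xz with h | ⟨α, -, k, h⟩
    · dsimp only at h; omega
    · have := α.b_le
      simp only [translate, Prod.mk.injEq] at h
      omega
  let f : τ.Triangle →
      Set.Icc (0 : ℤ) n × Set.Icc (0 : ℤ) (2 * n + 1) × Set.Icc (0 : ℤ) (2 * n + 1) := fun Δ =>
    (⟨Δ.x, Δ.x_nonneg, Δ.x_le⟩,
      ⟨Δ.y, by have := Δ.x_nonneg; have := Δ.x_lt; omega,
        by have := Δ.x_le; have := Δ.y_lt; have := hz Δ; omega⟩,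
      ⟨Δ.z, by have := Δ.x_nonneg; have := Δ.x_lt; have := Δ.y_lt; omega,
        by have := Δ.x_le; have := hz Δ; omega⟩)
  refine Finite.of_injective f fun Δ Δ' h => ?_
  simp only [f, Prod.mk.injEq] at h
  exact Triangle.ext (congrArg Subtype.val h.1) (congrArg Subtype.val h.2.1)
    (congrArg Subtype.val h.2.2)

instance : Finite τ.InternalTriangle := by
  let f : τ.InternalTriangle → τ.Triangle × (Fin 3 → τ.Vertex) := fun Δ => (Δ.toTriangle, Δ.arc)
  refine Finite.of_injective f fun Δ Δ' h => ?_
  cases Δ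
  cases Δ'
  simp only [f, Prod.mk.injEq] at h
  obtain ⟨rfl, rfl⟩ := h
  rfl

instance : Finite τ.PendingArc := inferInstanceAs (Finite {α : τ.Vertex // α.1.IsPending})

noncomputable instance : Fintype τ.InternalTriangle := Fintype.ofFinite _

noncomputable instance : Fintype τ.PendingArc := Fintype.ofFinite _

/-- The potential `S(τ)`: the sum of the 3-cycles of the internal triangles plus `ε³`. -/
noncomputable def potential : CompletedPathAlgebra τ.Vertex :=
  ∑ Δ : τ.InternalTriangle, ofPath Δ.cycle + ∑ α : τ.PendingArc, ofPath α.loopCubed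

/-- The algebra `Λ(τ) = 𝒫(Q(τ), S(τ))`. -/
abbrev Lam : Type := JacobianAlgebra τ.potential

end Triangulation

end OrbPoly

/-! A lift of an arc to the half plane lies below at most one triangle and above at most one, since
the sides of triangles do not cross. So if the two ends of every arrow of `Q(τ)` are labelled by the
sides of the arcs on which they lie, the arrows starting (or ending) at an arc have different labels
there. Take as relations the paths `b a` for which `a` arrives on the side from which `b` leaves:
these are the paths made of two arrows of one triangle, and `ε²`. Then all conditions on a gentle
algebra except admissibility are immediate.

Every cyclic derivative of `S(τ)` is zero or a nonzero multiple of one relation, and every relation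
arises. A path that contains no relation rotates around a marked point, so its length is bounded.
Therefore the relations generate an admissible ideal, the Jacobian ideal consists of the
combinations of paths that contain a relation, and cutting off long paths shows that the
quotients of `ℂ⟨Q⟩` and `ℂ⟨⟨Q⟩⟩` agree. -/

namespace OrbPoly

open Quiver CompletedPathAlgebra

/-! ### Quotients by two-sided ideals -/

theorem smul_mem_of_mem_twoSidedIdeal {R A : Type*} [CommSemiring R] [Ring A] [Algebra R A]
    {I : TwoSidedIdeal A} (c : R) {x : A} (hx : x ∈ I) : c • x ∈ I := by
  rw [Algebra.smul_def]
  exact I.mul_mem_left _ _ hx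

theorem exists_quotient_algEquiv_quotient {R A B : Type*} [CommSemiring R] [Ring A] [Ring B]
    [Algebra R A] [Algebra R B] (f : A →ₐ[R] B) {I : TwoSidedIdeal A} {J : TwoSidedIdeal B}
    (hIJ : ∀ x, x ∈ I ↔ f x ∈ J) (hf : ∀ y, ∃ x, y - f x ∈ J) :
    ∃ φ : I.ringCon.Quotient ≃ₐ[R] J.ringCon.Quotient,
      ∀ x, φ (I.ringCon.mk' x) = J.ringCon.mk' (f x) := by
  let g : A →ₐ[R] J.ringCon.Quotient := (J.ringCon.mkₐ R).comp f
  have hker : RingCon.ker g.toRingHom = I.ringCon := by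
    refine RingCon.ext fun x y => ?_
    rw [RingCon.ker_apply, TwoSidedIdeal.rel_iff, hIJ, map_sub, ← TwoSidedIdeal.rel_iff]
    exact J.ringCon.eq
  have hsurj : Function.Surjective g.toRingHom := fun y => by
    obtain ⟨b, rfl⟩ := J.ringCon.mk'_surjective y
    obtain ⟨x, hx⟩ := hf b
    exact ⟨x, (J.ringCon.eq.2 ((TwoSidedIdeal.rel_iff ..).2 hx)).symm⟩
  exact ⟨AlgEquiv.ofBijective (I.ringCon.liftₐ g hker.ge)
    (RingCon.lift_bijective_iff.2 ⟨hker.symm, hsurj⟩), fun _ => rfl⟩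

/-! ### Monomial ideals -/

section Splits

variable {V : Type*} [Quiver V]

theorem mem_splits_comp {i j k : V} (u : Path i k) (v : Path k j) :
    ⟨k, u, v⟩ ∈ splits (u.comp v) := by
  induction v with
  | nil => cases u <;> simp [splits]
  | cons v e ih => exact List.mem_cons_of_mem _ (List.mem_map.2 ⟨_, ih, rfl⟩)

theorem nodup_splits {i j : V} (p : Path i j) : (splits p).Nodup := by
  induction p with
  | nil => simp [splits]
  | cons p e ih =>
    refine List.nodup_cons.2 ⟨fun h => ?_, ih.map fun s t hst => ?_⟩
    · obtain ⟨⟨k, u, v⟩, -, hs⟩ := List.mem_map.1 h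
      simp only [Sigma.mk.injEq] at hs
      obtain ⟨rfl, hs⟩ := hs
      cases hs
    · obtain ⟨k, u, v⟩ := s
      obtain ⟨l, u', v'⟩ := t
      cases hst
      rfl

end Splits

namespace CompletedPathAlgebra

variable {V : Type*} [Quiver V]

theorem sum_apply {ι : Type*} (s : Finset ι) (f : ι → CompletedPathAlgebra V) (p : QPath V) :
    (∑ i ∈ s, f i) p = ∑ i ∈ s, f i p :=
  Finset.sum_apply (M := fun _ => ℂ) p s f

theorem sub_apply (f g : CompletedPathAlgebra V) (p : QPath V) : (f - g) p = f p - g p := by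
  rw [sub_eq_add_neg, add_apply, neg_apply, sub_eq_add_neg]

theorem ofPath_apply [DecidableEq (QPath V)] (p q : QPath V) :
    ofPath p q = if q = p then 1 else 0 := by
  unfold ofPath
  split_ifs <;> rfl

theorem ofPath_self (p : QPath V) : ofPath p p = 1 := by
  classical rw [ofPath_apply, if_pos rfl]

theorem ofPath_of_ne {p q : QPath V} (h : q ≠ p) : ofPath p q = 0 := by
  classical rw [ofPath_apply, if_neg h]

open scoped ComplexOrder in
theorem ofPath_nonneg (p q : QPath V) : 0 ≤ ofPath p q := by
  classical
  rw [ofPath_apply]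
  split_ifs
  exacts [zero_le_one, le_rfl]

theorem eq_smul_ofPath {f : CompletedPathAlgebra V} {p : QPath V} (h : ∀ q, f q ≠ 0 → q = p) :
    f = f p • ofPath p := by
  ext q
  by_cases hq : q = p
  · rw [hq, smul_apply, ofPath_self, mul_one]
  · rw [smul_apply, ofPath_of_ne hq, mul_zero]
    exact not_not.1 (mt (h q) hq)

theorem mul_apply_eq_zero {f g : CompletedPathAlgebra V} {i j : V} {p : Path i j}
    (h : ∀ (k : V) (u : Path i k) (v : Path k j), u.comp v = p →
      f ⟨k, j, v⟩ = 0 ∨ g ⟨i, k, u⟩ = 0) :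
    (f * g) ⟨i, j, p⟩ = 0 := by
  rw [mul_apply]
  refine List.sum_eq_zero fun c hc => ?_
  obtain ⟨s, hs, rfl⟩ := List.mem_map.1 hc
  exact mul_eq_zero.2 (h s.1 s.2.1 s.2.2 (splits_comp p s hs))

theorem ofPath_mul_ofPath {i j k : V} (p : Path i j) (q : Path j k) :
    ofPath ⟨j, k, q⟩ * ofPath ⟨i, j, p⟩ = ofPath ⟨i, k, p.comp q⟩ := by
  classical
  ext ⟨i', k', r⟩
  by_cases hr : (⟨i', k', r⟩ : QPath V) = ⟨i, k, p.comp q⟩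
  · cases hr
    have hterm : ∀ s : Σ l : V, Path i l × Path l k,
        ofPath ⟨j, k, q⟩ ⟨s.1, k, s.2.2⟩ * ofPath ⟨i, j, p⟩ ⟨i, s.1, s.2.1⟩ =
          if s = ⟨j, p, q⟩ then 1 else 0 := by
      rintro ⟨l, u, v⟩
      rw [ofPath_apply, ofPath_apply, mul_ite, mul_one, mul_zero, ← ite_and]
      refine if_congr ⟨?_, ?_⟩ rfl rfl
      · rintro ⟨hu, hv⟩
        cases hu
        cases hv
        rfl
      · intro h
        cases h
        exact ⟨rfl, rfl⟩
    rw [ofPath_self, mul_apply, List.map_congr_left fun s _ => hterm s,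
      ← List.sum_toFinset _ (nodup_splits _), Finset.sum_ite_eq',
      if_pos (List.mem_toFinset.2 (mem_splits_comp p q))]
  · rw [ofPath_of_ne hr]
    refine mul_apply_eq_zero fun l u v huv => ?_
    by_contra! h
    have hv := not_not.1 (mt ofPath_of_ne h.1)
    have hu := not_not.1 (mt ofPath_of_ne h.2)
    cases hu
    cases hv
    exact hr (by rw [huv])

theorem mem_arrowIdealPow {f : CompletedPathAlgebra V} {m : ℕ} :
    f ∈ arrowIdealPow V m ↔ ∀ p : QPath V, p.len < m → f p = 0 :=
  TwoSidedIdeal.mem_mk' ..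

theorem closure_le_sup_arrowIdealPow (I : TwoSidedIdeal (CompletedPathAlgebra V)) (m : ℕ) :
    closure I ≤ I ⊔ arrowIdealPow V m :=
  iInf_le _ m

end CompletedPathAlgebra

section Avoids

variable {V : Type*} [Quiver V] {P : Set (QPath V)}

/-- The path `p` has no subpath in `P`. The paths avoiding `P` are a basis of `ℂ⟨Q⟩ / ⟨P⟩`. -/
def Avoids (P : Set (QPath V)) {i j : V} (p : Path i j) : Prop :=
  ∀ ⦃k l : V⦄ (u : Path i k) (r : Path k l) (v : Path l j),
    p = (u.comp r).comp v → (⟨k, l, r⟩ : QPath V) ∉ P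

theorem Avoids.of_comp_left {i j k : V} {p : Path i j} {q : Path j k}
    (h : Avoids P (p.comp q)) : Avoids P p := fun _ _ u r v hp =>
  h u r (v.comp q) (by rw [hp, Path.comp_assoc (u.comp r)])

theorem Avoids.of_comp_right {i j k : V} {p : Path i j} {q : Path j k}
    (h : Avoids P (p.comp q)) : Avoids P q := fun _ _ u r v hq =>
  h (p.comp u) r v (by rw [hq, Path.comp_assoc p u r, Path.comp_assoc p])

theorem avoids_of_length_lt {m : ℕ} (hP : ∀ p ∈ P, m ≤ p.len) {i j : V} {p : Path i j}
    (hp : p.length < m) : Avoids P p := fun k l u r v h hr => by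
  have hm : m ≤ r.length := hP _ hr
  rw [h, Path.length_comp, Path.length_comp] at hp
  omega

theorem Avoids.length_le_of_rank_lt {rank : ∀ {i j : V}, (i ⟶ j) → ℕ} {m : ℕ}
    (hm : ∀ {i j : V} (a : i ⟶ j), rank a < m)
    (hrank : ∀ {i j k : V} (a : i ⟶ j) (b : j ⟶ k), path₂ b a ∉ P → rank a < rank b)
    {i j : V} {p : Path i j} (hp : Avoids P p) : p.length ≤ m := by
  have length_le_rank {i j k : V} (p : Path i j) (b : j ⟶ k) (hp : Avoids P (p.cons b)) :
      p.length ≤ rank b := by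
    induction p generalizing k with
    | nil => exact Nat.zero_le _
    | cons p a ih =>
      have ha : Avoids P (p.cons a) := hp.of_comp_left (q := b.toPath)
      have hab : rank a < rank b := hrank a b (hp p (a.toPath.comp b.toPath) .nil rfl)
      exact (Nat.succ_le_succ (ih a ha)).trans hab
  cases p with
  | nil => exact Nat.zero_le m
  | cons p b => exact (length_le_rank p b hp).trans_lt (hm b)

/-- The combinations of paths none of which avoids `P`, the completed counterpart of the
ideal `⟨P⟩` of the path algebra. -/
noncomputable def monomialIdeal (P : Set (QPath V)) : TwoSidedIdeal (CompletedPathAlgebra V) :=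
  TwoSidedIdeal.mk' {f | ∀ (i j : V) (p : Path i j), Avoids P p → f ⟨i, j, p⟩ = 0}
    (fun _ _ _ _ => rfl)
    (fun hf hg i j p hp => by
      rw [CompletedPathAlgebra.add_apply, hf i j p hp, hg i j p hp, add_zero])
    (fun hf i j p hp => by rw [CompletedPathAlgebra.neg_apply, hf i j p hp, neg_zero])
    (fun hg _ _ _ hp => mul_apply_eq_zero fun _ _ _ h =>
      .inr (hg _ _ _ (Avoids.of_comp_left (h ▸ hp))))
    (fun hf _ _ _ hp => mul_apply_eq_zero fun _ _ _ h =>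
      .inl (hf _ _ _ (Avoids.of_comp_right (h ▸ hp))))

theorem mem_monomialIdeal {f : CompletedPathAlgebra V} :
    f ∈ monomialIdeal P ↔ ∀ (i j : V) (p : Path i j), Avoids P p → f ⟨i, j, p⟩ = 0 :=
  TwoSidedIdeal.mem_mk' ..

theorem ofPath_mem_monomialIdeal {p : QPath V} (hp : p ∈ P) : ofPath p ∈ monomialIdeal P :=
  mem_monomialIdeal.2 fun i j q hq => ofPath_of_ne fun h => by
    subst h
    exact hq .nil q .nil (by rw [Path.nil_comp, Path.comp_nil]) hp

theorem arrowIdealPow_le_monomialIdeal {m : ℕ}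
    (hm : ∀ {i j : V} (p : Path i j), Avoids P p → p.length < m) :
    arrowIdealPow V m ≤ monomialIdeal P := fun _ hf =>
  mem_monomialIdeal.2 fun _ _ p hp => mem_arrowIdealPow.1 hf _ (hm p hp)

theorem closure_le_monomialIdeal {I : TwoSidedIdeal (CompletedPathAlgebra V)}
    (hI : I ≤ monomialIdeal P) : closure I ≤ monomialIdeal P := fun f hf =>
  mem_monomialIdeal.2 fun i j p hp => by
    obtain ⟨g, hg, h, hh, rfl⟩ :=
      TwoSidedIdeal.mem_sup.1 (closure_le_sup_arrowIdealPow I (p.length + 1) hf)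
    rw [CompletedPathAlgebra.add_apply, mem_monomialIdeal.1 (hI hg) i j p hp,
      mem_arrowIdealPow.1 hh _ (Nat.lt_succ_self _), add_zero]

end Avoids

namespace PathAlgebra

variable {V : Type*} [Quiver V] [Finite V]

/-- The path `p` as an element of the path algebra. -/
noncomputable def single (p : QPath V) : PathAlgebra V :=
  ⟨ofPath p, (Set.finite_singleton p).subset fun _ hq => not_not.1 (mt ofPath_of_ne hq)⟩

theorem single_mul_single {i j k : V} (p : Path i j) (q : Path j k) :
    single ⟨j, k, q⟩ * single ⟨i, j, p⟩ = single ⟨i, k, p.comp q⟩ :=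
  Subtype.ext (ofPath_mul_ofPath p q)

/-- The finite set of paths that occur in an element of the path algebra. -/
noncomputable def support (x : PathAlgebra V) : Finset (QPath V) := Set.Finite.toFinset x.2

theorem mem_support {x : PathAlgebra V} {p : QPath V} :
    p ∈ support x ↔ (x : CompletedPathAlgebra V) p ≠ 0 :=
  Set.Finite.mem_toFinset _

theorem eq_sum_smul_single (x : PathAlgebra V) :
    x = ∑ p ∈ support x, (x : CompletedPathAlgebra V) p • single p := by
  classical
  refine Subtype.ext (CompletedPathAlgebra.ext fun q => ?_)
  have hterm : ∀ p ∈ support x, ((x.1 p • single p : PathAlgebra V) : CompletedPathAlgebra V) q =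
      if q = p then x.1 p else 0 := fun p _ => by
    rw [← mul_one (x.1 p), ← mul_zero (x.1 p), ← mul_ite, ← ofPath_apply, mul_one]
    rfl
  rw [AddSubmonoidClass.coe_finsetSum, CompletedPathAlgebra.sum_apply,
    Finset.sum_congr rfl hterm, Finset.sum_ite_eq (support x) q fun p => x.1 p, eq_comm,
    ite_eq_left_iff]
  exact fun h => (not_not.1 (mt mem_support.2 h)).symm

variable {P : Set (QPath V)}

theorem single_mem_pathIdeal {i j : V} {p : Path i j} (hp : ¬ Avoids P p) :
    single ⟨i, j, p⟩ ∈ pathIdeal P := by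
  unfold Avoids at hp
  push Not at hp
  obtain ⟨k, l, u, r, v, rfl, hr⟩ := hp
  rw [← single_mul_single, ← single_mul_single]
  exact TwoSidedIdeal.mul_mem_left _ _ _ (TwoSidedIdeal.mul_mem_right _ _ _
    (TwoSidedIdeal.subset_span ⟨_, hr, rfl⟩))

theorem coe_mem_of_mem_pathIdeal {I : TwoSidedIdeal (CompletedPathAlgebra V)}
    (hP : ∀ p ∈ P, ofPath p ∈ I) {x : PathAlgebra V} (hx : x ∈ pathIdeal P) :
    (x : CompletedPathAlgebra V) ∈ I := by
  have hle : pathIdeal P ≤ I.comap (PathAlgebra V).val := by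
    refine TwoSidedIdeal.span_le.2 ?_
    rintro y ⟨p, hp, hy⟩
    refine (TwoSidedIdeal.mem_comap _).2 (?_ : (y : CompletedPathAlgebra V) ∈ I)
    exact hy ▸ hP p hp
  exact (TwoSidedIdeal.mem_comap _).1 (hle hx)

theorem mem_pathIdeal_iff {x : PathAlgebra V} :
    x ∈ pathIdeal P ↔ (x : CompletedPathAlgebra V) ∈ monomialIdeal P := by
  refine ⟨coe_mem_of_mem_pathIdeal fun p => ofPath_mem_monomialIdeal, fun hx => ?_⟩
  rw [eq_sum_smul_single x]
  exact sum_mem fun p hp => smul_mem_of_mem_twoSidedIdeal _ <| single_mem_pathIdeal fun h =>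
    mem_support.1 hp (mem_monomialIdeal.1 hx _ _ _ h)

end PathAlgebra

section Truncation

variable {V : Type*} [Quiver V] [Finite V] [∀ i j : V, Finite (i ⟶ j)]

theorem finite_setOf_len_lt (m : ℕ) : {p : QPath V | p.len < m}.Finite := by
  induction m with
  | zero => simp only [Nat.not_lt_zero, Set.ofPred_false, Set.finite_empty]
  | succ m ih =>
    refine ((Set.finite_range fun i : V => (⟨i, i, .nil⟩ : QPath V)).union
      (ih.biUnion fun p _ => Set.finite_range fun a : Σ k : V, p.2.1 ⟶ k =>
        (⟨p.1, a.1, p.2.2.cons a.2⟩ : QPath V))).subset ?_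
    rintro ⟨i, j, p⟩ hp
    cases p with
    | nil => exact .inl ⟨i, rfl⟩
    | cons p a =>
      have hp' : (⟨i, _, p⟩ : QPath V) ∈ {p : QPath V | p.len < m} := Nat.lt_of_succ_lt_succ hp
      exact .inr (Set.mem_biUnion hp' ⟨⟨j, a⟩, rfl⟩)

/-- The part of an element of the completed path algebra that involves the paths of length less
than `m`. -/
noncomputable def truncate (m : ℕ) (f : CompletedPathAlgebra V) : PathAlgebra V :=
  ⟨fun p => if p.len < m then f p else 0,
    (finite_setOf_len_lt m).subset fun _ hp => of_not_not fun h => hp (if_neg h)⟩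

theorem truncate_apply (m : ℕ) (f : CompletedPathAlgebra V) (p : QPath V) :
    (truncate m f : CompletedPathAlgebra V) p = if p.len < m then f p else 0 := rfl

theorem sub_truncate_mem_arrowIdealPow (m : ℕ) (f : CompletedPathAlgebra V) :
    f - truncate m f ∈ arrowIdealPow V m :=
  mem_arrowIdealPow.2 fun p hp => by
    rw [CompletedPathAlgebra.sub_apply, truncate_apply, if_pos hp, sub_self]

variable {P : Set (QPath V)}

theorem truncate_mem_pathIdeal (m : ℕ) {f : CompletedPathAlgebra V} (hf : f ∈ monomialIdeal P) :
    truncate m f ∈ pathIdeal P :=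
  PathAlgebra.mem_pathIdeal_iff.2 <| mem_monomialIdeal.2 fun i j p hp => by
    rw [truncate_apply, mem_monomialIdeal.1 hf i j p hp, ite_self]

theorem monomialIdeal_le_closure {I : TwoSidedIdeal (CompletedPathAlgebra V)}
    (hP : ∀ p ∈ P, ofPath p ∈ I) : monomialIdeal P ≤ closure I := fun f hf =>
  (TwoSidedIdeal.mem_iInf _).2 fun m => by
    rw [← sub_add_cancel f (truncate m f : CompletedPathAlgebra V)]
    exact TwoSidedIdeal.add_mem _
      (TwoSidedIdeal.mem_sup_right (sub_truncate_mem_arrowIdealPow m f))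
      (TwoSidedIdeal.mem_sup_left
        (PathAlgebra.coe_mem_of_mem_pathIdeal hP (truncate_mem_pathIdeal m hf)))

theorem exists_algEquiv_quotient_monomialIdeal {m : ℕ}
    (hm : ∀ {i j : V} (p : Path i j), Avoids P p → p.length < m) :
    ∃ φ : (pathIdeal P).ringCon.Quotient ≃ₐ[ℂ] (monomialIdeal P).ringCon.Quotient,
      ∀ x : PathAlgebra V, φ ((pathIdeal P).ringCon.mk' x) =
        (monomialIdeal P).ringCon.mk' (x : CompletedPathAlgebra V) :=
  exists_quotient_algEquiv_quotient (PathAlgebra V).val (fun _ => PathAlgebra.mem_pathIdeal_iff)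
    fun f => ⟨truncate m f,
      arrowIdealPow_le_monomialIdeal hm (sub_truncate_mem_arrowIdealPow m f)⟩

end Truncation

/-! ### Cyclic derivatives -/

section CyclicDerivative

variable {V : Type*} [Quiver V] {S : CompletedPathAlgebra V} {i j k : V} {a : i ⟶ j}

theorem cyclicDerivative_apply (p : Path j i) :
    cyclicDerivative a S ⟨j, i, p⟩ =
      ((splits p).map fun s => S ⟨_, _, (s.2.2.cons a).comp s.2.1⟩).sum :=
  dif_pos ⟨rfl, rfl⟩

theorem exists_of_cyclicDerivative_ne_zero {p : QPath V} (h : cyclicDerivative a S p ≠ 0) :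
    ∃ (k : V) (u : Path j k) (v : Path k i), p = ⟨j, i, u.comp v⟩ ∧
      S ⟨k, k, (v.cons a).comp u⟩ ≠ 0 := by
  by_cases hp : p.1 = j ∧ p.2.1 = i
  · obtain ⟨j', i', p⟩ := p
    obtain ⟨rfl, rfl⟩ := hp
    rw [cyclicDerivative_apply] at h
    obtain ⟨c, hc, hc0⟩ := List.exists_mem_ne_zero_of_sum_ne_zero h
    obtain ⟨s, hs, rfl⟩ := List.mem_map.1 hc
    exact ⟨s.1, s.2.1, s.2.2, by rw [splits_comp p s hs], hc0⟩
  · exact absurd (dif_neg hp) h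

open scoped ComplexOrder in
theorem cyclicDerivative_apply_ne_zero (hS : ∀ q, 0 ≤ S q) (u : Path j k) (v : Path k i)
    (h : S ⟨k, k, (v.cons a).comp u⟩ ≠ 0) : cyclicDerivative a S ⟨j, i, u.comp v⟩ ≠ 0 := by
  rw [cyclicDerivative_apply]
  refine fun h₀ => h (List.all_zero_of_le_zero_le_of_sum_eq_zero (fun x hx => ?_) h₀
    (List.mem_map_of_mem (mem_splits_comp u v)))
  obtain ⟨s, -, rfl⟩ := List.mem_map.1 hx
  exact hS _

end CyclicDerivative

/-! ### Polarizations -/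

section ArrowList

variable {V : Type*} [Quiver V]

/-- The arrows of a path, the last one first. -/
def arrowList {i : V} : {j : V} → Path i j → List (Σ k l : V, k ⟶ l)
  | _, .nil => []
  | _, .cons p e => ⟨_, _, e⟩ :: arrowList p

theorem arrowList_comp {i j k : V} (p : Path i j) (q : Path j k) :
    arrowList (p.comp q) = arrowList q ++ arrowList p := by
  induction q with
  | nil => rfl
  | cons _ _ ih => exact congrArg (List.cons _) ih

theorem exists_eq_cons_cons {i j : V} (p : Path i j) (hp : p.length = 2) :
    ∃ (k : V) (a : i ⟶ k) (b : k ⟶ j), p = (Path.nil.cons a).cons b := by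
  match p, hp with
  | .cons (.cons .nil a) b, _ => exact ⟨_, a, b, rfl⟩

end ArrowList

/-- A labelling of the two ends of every arrow by `Bool` such that arrows with the same tail are
told apart by the labels at their tails, and arrows with the same head by the labels at their
heads. Declaring a path `b a` a relation if the labels at its middle vertex agree makes the quiver
gentle, except possibly for admissibility. -/
structure Polarization (V : Type*) [Quiver V] where
  tail : ∀ {i j : V}, (i ⟶ j) → Bool
  head : ∀ {i j : V}, (i ⟶ j) → Bool
  tail_inj : ∀ {i j k : V} (a : i ⟶ j) (b : i ⟶ k), tail a = tail b →
    (⟨j, a⟩ : Σ l : V, i ⟶ l) = ⟨k, b⟩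
  head_inj : ∀ {i j k : V} (a : i ⟶ k) (b : j ⟶ k), head a = head b →
    (⟨i, a⟩ : Σ l : V, l ⟶ k) = ⟨j, b⟩

namespace Polarization

section Relations

variable {V : Type*} [Quiver V]

theorem finite_hom (π : Polarization V) (i j : V) : Finite (i ⟶ j) :=
  Finite.of_injective (fun a : i ⟶ j => π.tail a) fun a b h =>
    eq_of_heq (Sigma.mk.inj (π.tail_inj a b h)).2

theorem card_tail_le (π : Polarization V) (i : V) : ENat.card (Σ j : V, i ⟶ j) ≤ 2 := by
  have h : Function.Injective fun a : Σ j : V, i ⟶ j => π.tail a.2 := fun a b h =>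
    π.tail_inj a.2 b.2 h
  simpa using ENat.card_le_card_of_injective h

theorem card_head_le (π : Polarization V) (i : V) : ENat.card (Σ j : V, j ⟶ i) ≤ 2 := by
  have h : Function.Injective fun a : Σ j : V, j ⟶ i => π.head a.2 := fun a b h =>
    π.head_inj a.2 b.2 h
  simpa using ENat.card_le_card_of_injective h

variable (π : Polarization V)

/-- The paths `b a` of length two whose labels at the middle vertex agree. -/
def relations : Set (QPath V) :=
  {p | ∃ (i j k : V) (a : i ⟶ j) (b : j ⟶ k), π.head a = π.tail b ∧ p = path₂ b a}

theorem path₂_mem_relations {i j k : V} {a : i ⟶ j} {b : j ⟶ k} :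
    path₂ b a ∈ π.relations ↔ π.head a = π.tail b := by
  refine ⟨?_, fun h => ⟨_, _, _, a, b, h, rfl⟩⟩
  rintro ⟨_, _, _, a', b', h, hp⟩
  cases hp
  exact h

theorem len_eq_two_of_mem_relations {p : QPath V} (hp : p ∈ π.relations) : p.len = 2 := by
  obtain ⟨i, j, k, a, b, -, rfl⟩ := hp
  rfl

theorem encard_setOf_head_eq_le (i : V) (c : Bool) :
    {b : Σ k : V, k ⟶ i | π.head b.2 = c}.encard ≤ 1 :=
  Set.encard_le_one_iff.2 fun a b ha hb => π.head_inj a.2 b.2 (ha.trans hb.symm)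

theorem encard_setOf_tail_eq_le (i : V) (c : Bool) :
    {b : Σ k : V, i ⟶ k | π.tail b.2 = c}.encard ≤ 1 :=
  Set.encard_le_one_iff.2 fun a b ha hb => π.tail_inj a.2 b.2 (ha.trans hb.symm)

theorem isGentle [Finite V] {m : ℕ}
    (hm : ∀ {i j : V} (p : Path i j), Avoids π.relations p → p.length < m) :
    IsGentle π.relations where
  tail_le := π.card_tail_le
  head_le := π.card_head_le
  before_le i j a := by
    simpa only [path₂_mem_relations, ← ne_eq, Bool.eq_not] using
      π.encard_setOf_head_eq_le i (!π.tail a)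
  after_le i j a := by
    simpa only [path₂_mem_relations, ← ne_eq, ne_comm, Bool.eq_not] using
      π.encard_setOf_tail_eq_le j (!π.head a)
  le_sq x hx p hp :=
    mem_monomialIdeal.1 (PathAlgebra.mem_pathIdeal_iff.1 hx) _ _ _
      (avoids_of_length_lt (fun _ h => (π.len_eq_two_of_mem_relations h).ge) hp)
  pow_le := ⟨m, fun x hx => PathAlgebra.mem_pathIdeal_iff.2
    (arrowIdealPow_le_monomialIdeal hm (mem_arrowIdealPow.2 hx))⟩
  len_eq _ := π.len_eq_two_of_mem_relations
  before_mem_le i j a := by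
    simpa only [path₂_mem_relations] using π.encard_setOf_head_eq_le i (π.tail a)
  after_mem_le i j a := by
    simpa only [path₂_mem_relations, eq_comm] using π.encard_setOf_tail_eq_le j (π.head a)

end Relations

section Jacobian

variable {V : Type*} [Quiver V] (π : Polarization V) {S : CompletedPathAlgebra V}

/-- The potential `S` is a combination of 3-cycles all of whose cyclic subpaths of length two are
relations. -/
def SupportedOnTriangles (S : CompletedPathAlgebra V) : Prop :=
  ∀ q : QPath V, S q ≠ 0 → q.len = 3 ∧
    (arrowList q.2.2 : Cycle (Σ k l : V, k ⟶ l)).Chain fun b a => π.head a.2.2 = π.tail b.2.2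

variable {π}

theorem SupportedOnTriangles.of_cyclicDerivative_ne_zero (hS : π.SupportedOnTriangles S)
    {i j : V} {c : i ⟶ j} {p : QPath V} (h : cyclicDerivative c S p ≠ 0) :
    ∃ (k : V) (a : j ⟶ k) (b : k ⟶ i), p = path₂ b a ∧
      π.head c = π.tail a ∧ π.head a = π.tail b := by
  obtain ⟨k, u, v, rfl, hne⟩ := exists_of_cyclicDerivative_ne_zero h
  obtain ⟨hlen, hchain⟩ := hS _ hne
  have huv : (u.comp v).length = 2 := by
    simp only [QPath.len, Path.length_comp, Path.length_cons] at hlen ⊢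
    omega
  obtain ⟨l, a, b, hab⟩ := exists_eq_cons_cons _ huv
  have hrot : (arrowList ((v.cons c).comp u) : Cycle (Σ k l : V, k ⟶ l)) =
      ↑[(⟨i, j, c⟩ : Σ k l : V, k ⟶ l), ⟨l, i, b⟩, ⟨j, l, a⟩] := by
    have h : [(⟨l, i, b⟩ : Σ k l : V, k ⟶ l), ⟨j, l, a⟩] = arrowList v ++ arrowList u := by
      rw [← arrowList_comp, hab]
      rfl
    rw [arrowList_comp, h]
    exact Cycle.coe_eq_coe.2 List.isRotated_append
  rw [hrot, Cycle.chain_coe_cons] at hchain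
  simp only [List.cons_append, List.nil_append, List.isChain_cons_cons] at hchain
  exact ⟨l, a, b, by rw [hab]; rfl, hchain.2.2.1, hchain.2.1⟩

theorem SupportedOnTriangles.cyclicDerivative_mem_monomialIdeal (hS : π.SupportedOnTriangles S)
    {i j : V} (c : i ⟶ j) : cyclicDerivative c S ∈ monomialIdeal π.relations := by
  refine mem_monomialIdeal.2 fun i' j' p hp => ?_
  by_contra h
  obtain ⟨k, a, b, hab, -, hrel⟩ := hS.of_cyclicDerivative_ne_zero h
  cases hab
  exact hp .nil _ .nil rfl (π.path₂_mem_relations.2 hrel)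

theorem SupportedOnTriangles.cyclicDerivative_eq_smul_ofPath (hS : π.SupportedOnTriangles S)
    {i j k : V} {a : i ⟶ j} {b : j ⟶ k} {c : k ⟶ i} (hab : path₂ b a ∈ π.relations)
    (hc : cyclicDerivative c S (path₂ b a) ≠ 0) :
    cyclicDerivative c S = cyclicDerivative c S (path₂ b a) • ofPath (path₂ b a) := by
  refine eq_smul_ofPath fun q hq => ?_
  obtain ⟨_, a₁, b₁, h₁, hca, -⟩ := hS.of_cyclicDerivative_ne_zero hc
  cases h₁
  obtain ⟨_, a₂, b₂, rfl, hca₂, hab₂⟩ := hS.of_cyclicDerivative_ne_zero hq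
  cases π.tail_inj a a₂ (hca.symm.trans hca₂)
  cases π.tail_inj b b₂ ((π.path₂_mem_relations.1 hab).symm.trans hab₂)
  rfl

variable [Finite V]

theorem SupportedOnTriangles.jacobianIdeal_eq_monomialIdeal (hS : π.SupportedOnTriangles S)
    (hrel : ∀ {i j k : V} (a : i ⟶ j) (b : j ⟶ k), path₂ b a ∈ π.relations →
      ∃ c : k ⟶ i, cyclicDerivative c S (path₂ b a) ≠ 0) :
    jacobianIdeal S = monomialIdeal π.relations := by
  have := π.finite_hom
  refine le_antisymm (closure_le_monomialIdeal (TwoSidedIdeal.span_le.2 ?_))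
    (monomialIdeal_le_closure ?_)
  · rintro _ ⟨i, j, c, rfl⟩
    exact hS.cyclicDerivative_mem_monomialIdeal c
  · rintro _ ⟨i, j, k, a, b, hab, rfl⟩
    have hab := π.path₂_mem_relations.2 hab
    obtain ⟨c, hc⟩ := hrel a b hab
    rw [← inv_smul_smul₀ hc (ofPath (path₂ b a)),
      ← hS.cyclicDerivative_eq_smul_ofPath hab hc]
    exact smul_mem_of_mem_twoSidedIdeal _ (TwoSidedIdeal.subset_span ⟨_, _, c, rfl⟩)

theorem SupportedOnTriangles.exists_algEquiv_jacobianAlgebra (hS : π.SupportedOnTriangles S)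
    (hrel : ∀ {i j k : V} (a : i ⟶ j) (b : j ⟶ k), path₂ b a ∈ π.relations →
      ∃ c : k ⟶ i, cyclicDerivative c S (path₂ b a) ≠ 0) {m : ℕ}
    (hm : ∀ {i j : V} (p : Path i j), Avoids π.relations p → p.length < m) :
    ∃ φ : (pathIdeal π.relations).ringCon.Quotient ≃ₐ[ℂ] JacobianAlgebra S,
      ∀ x : PathAlgebra V, φ ((pathIdeal π.relations).ringCon.mk' x) =
        (jacobianIdeal S).ringCon.mk' (x : CompletedPathAlgebra V) := by
  have := π.finite_hom
  unfold JacobianAlgebra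
  rw [hS.jacobianIdeal_eq_monomialIdeal hrel]
  exact exists_algEquiv_quotient_monomialIdeal hm

end Jacobian

end Polarization

/-! ### Triangles and arcs -/

namespace Arc

variable {n : ℕ} {α : Arc n} {p : ℤ × ℤ}

/-- The number of boundary segments in the boundary path to which an arc is homotopic. -/
def width (α : Arc n) : ℕ := (α.b - α.a).toNat

theorem width_le (α : Arc n) : α.width ≤ n + 1 := by
  have h := α.b_le
  unfold width
  omega

theorem IsLift.width_eq (h : α.IsLift p) : (α.width : ℤ) = p.2 - p.1 := by
  obtain ⟨k, rfl⟩ := h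
  have h := α.lt
  simp only [width, translate, add_sub_add_right_eq_sub]
  omega

theorem IsLift.translate (h : α.IsLift p) (k : ℤ) : α.IsLift (OrbPoly.translate n k p) := by
  obtain ⟨l, rfl⟩ := h
  exact ⟨l + k, by simp only [OrbPoly.translate, add_mul, add_assoc]⟩

theorem IsLift.exists_translate_eq (h : α.IsLift p) :
    ∃ k : ℤ, OrbPoly.translate n k p = (α.a, α.b) := by
  obtain ⟨k, rfl⟩ := h
  exact ⟨-k, by simp only [OrbPoly.translate, neg_mul, add_neg_cancel_right]⟩

end Arc

theorem eq_of_add_mul_eq_add_mul {n : ℕ} {x x' k k' : ℤ} (hx : 0 ≤ x) (hxn : x ≤ n) (hx' : 0 ≤ x')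
    (hxn' : x' ≤ n) (h : x + k * (n + 1) = x' + k' * (n + 1)) : k = k' := by
  rcases lt_trichotomy k k' with hk | hk | hk
  · nlinarith
  · exact hk
  · nlinarith

theorem Arc.IsLift.unique {n : ℕ} {α β : Arc n} {p : ℤ × ℤ} (hα : α.IsLift p)
    (hβ : β.IsLift p) : α = β := by
  obtain ⟨k, rfl⟩ := hα
  obtain ⟨l, h⟩ := hβ
  obtain ⟨ha, hb⟩ := Prod.mk.inj h
  obtain rfl : k = l :=
    eq_of_add_mul_eq_add_mul α.a_nonneg α.a_le β.a_nonneg β.a_le ha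
  exact Arc.ext (add_right_cancel ha) (add_right_cancel hb)

namespace Triangulation

variable {n : ℕ} {τ : Triangulation n}

theorem IsSide.translate {p : ℤ × ℤ} (h : τ.IsSide p) (k : ℤ) : τ.IsSide (translate n k p) := by
  rcases h with h | ⟨α, hα, h⟩
  · exact .inl (by simp only [OrbPoly.translate, h, add_right_comm])
  · exact .inr ⟨α, hα, h.translate k⟩

theorem IsSide.not_interlace {p q : ℤ × ℤ} (hp : τ.IsSide p) (hq : τ.IsSide q) :
    ¬ Interlace p q := by
  rcases hp with hp | ⟨α, hα, hp⟩
  · unfold Interlace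
    omega
  rcases hq with hq | ⟨β, hβ, hq⟩
  · unfold Interlace
    omega
  exact τ.compatible α hα β hβ p q hp hq

theorem IsSide.snd_le {p : ℤ × ℤ} (hp : τ.IsSide p) : p.2 ≤ p.1 + (n + 1) := by
  rcases hp with hp | ⟨α, -, hp⟩
  · omega
  · have h := hp.width_eq
    have hα := α.width_le
    omega

/-- `x < y < z` are the vertices of an arbitrary lift of a triangle of `τ`. -/
structure IsTriangle (τ : Triangulation n) (x y z : ℤ) : Prop where
  x_lt : x < y
  y_lt : y < z
  side_xy : τ.IsSide (x, y)
  side_yz : τ.IsSide (y, z)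
  side_xz : τ.IsSide (x, z)

namespace IsTriangle

variable {w x x' y y' z z' : ℤ}

theorem eq_mid (h : τ.IsTriangle x y z) (h' : τ.IsTriangle x y' z) : y = y' := by
  have hy := h.y_lt
  have hy' := h'.y_lt
  have hlt := h.side_xy.not_interlace h'.side_yz
  have hgt := h'.side_xy.not_interlace h.side_yz
  have hx := h.x_lt
  have hx' := h'.x_lt
  simp only [Interlace] at hlt hgt
  omega

theorem eq_left (h : τ.IsTriangle x y z) (h' : τ.IsTriangle x' y z) : x = x' := by
  have hx := h.x_lt
  have hx' := h'.x_lt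
  have hy := h.y_lt
  have hlt := h.side_xy.not_interlace h'.side_xz
  have hgt := h'.side_xy.not_interlace h.side_xz
  simp only [Interlace] at hlt hgt
  omega

theorem eq_right (h : τ.IsTriangle x y z) (h' : τ.IsTriangle x y z') : z = z' := by
  have hx := h.x_lt
  have hy := h.y_lt
  have hy' := h'.y_lt
  have hlt := h'.side_yz.not_interlace h.side_xz
  have hgt := h.side_yz.not_interlace h'.side_xz
  simp only [Interlace] at hlt hgt
  omega

theorem not_left_right (h : τ.IsTriangle w x y) : ¬ τ.IsTriangle x y z := fun h' =>
  h.side_xz.not_interlace h'.side_xz (.inl ⟨h.x_lt, h.y_lt, h'.y_lt⟩)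

/-- A triangle lies below its side with index `0` and above the others, so the hypothesis on `k`
and `k'` says that both triangles lie on the same side of the arc. -/
theorem unique (h : τ.IsTriangle x y z) (h' : τ.IsTriangle x' y' z') {k k' : Fin 3}
    (hk : k = 0 ↔ k' = 0)
    (hs : (![(x, z), (y, z), (x, y)] : Fin 3 → ℤ × ℤ) k = ![(x', z'), (y', z'), (x', y')] k') :
    k = k' ∧ x = x' ∧ y = y' ∧ z = z' := by
  match k, k', hk with
  | 0, 0, _ =>
    obtain ⟨rfl, rfl⟩ := Prod.mk.inj hs
    exact ⟨rfl, rfl, h.eq_mid h', rfl⟩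
  | 1, 1, _ =>
    obtain ⟨rfl, rfl⟩ := Prod.mk.inj hs
    exact ⟨rfl, h.eq_left h', rfl, rfl⟩
  | 2, 2, _ =>
    obtain ⟨rfl, rfl⟩ := Prod.mk.inj hs
    exact ⟨rfl, rfl, rfl, h.eq_right h'⟩
  | 1, 2, _ =>
    obtain ⟨rfl, rfl⟩ := Prod.mk.inj hs
    exact absurd h' h.not_left_right
  | 2, 1, _ =>
    obtain ⟨rfl, rfl⟩ := Prod.mk.inj hs
    exact absurd h h'.not_left_right
  | 0, 1, hk | 0, 2, hk | 1, 0, hk | 2, 0, hk => simp at hk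

end IsTriangle

namespace Triangle

theorem translate_side (Δ : τ.Triangle) (m : ℤ) (k : Fin 3) :
    translate n m (Δ.side k) =
      (![(Δ.x + m * (n + 1), Δ.z + m * (n + 1)), (Δ.y + m * (n + 1), Δ.z + m * (n + 1)),
        (Δ.x + m * (n + 1), Δ.y + m * (n + 1))] : Fin 3 → ℤ × ℤ) k := by
  fin_cases k <;> rfl

theorem isTriangle (Δ : τ.Triangle) (m : ℤ) :
    τ.IsTriangle (Δ.x + m * (n + 1)) (Δ.y + m * (n + 1)) (Δ.z + m * (n + 1)) where
  x_lt := add_lt_add_left Δ.x_lt _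
  y_lt := add_lt_add_left Δ.y_lt _
  side_xy := Δ.side_xy.translate m
  side_yz := Δ.side_yz.translate m
  side_xz := Δ.side_xz.translate m

theorem unique {α : Arc n} {Δ Δ' : τ.Triangle} {k k' : Fin 3} (h : α.IsLift (Δ.side k))
    (h' : α.IsLift (Δ'.side k')) (hk : k = 0 ↔ k' = 0) : Δ = Δ' ∧ k = k' := by
  obtain ⟨m, hm⟩ := h.exists_translate_eq
  obtain ⟨m', hm'⟩ := h'.exists_translate_eq
  have hs := hm.trans hm'.symm
  rw [translate_side, translate_side] at hs
  obtain ⟨rfl, hx, hy, hz⟩ := (Δ.isTriangle m).unique (Δ'.isTriangle m') hk hs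
  obtain rfl : m = m' :=
    eq_of_add_mul_eq_add_mul Δ.x_nonneg Δ.x_le Δ'.x_nonneg Δ'.x_le hx
  exact ⟨Triangle.ext (add_right_cancel hx) (add_right_cancel hy) (add_right_cancel hz), rfl⟩

theorem eq_zero_of_isPending {α : Arc n} (hα : α.IsPending) {Δ : τ.Triangle} {k : Fin 3}
    (h : α.IsLift (Δ.side k)) : k = 0 := by
  have hw : α.width = (n + 1 : ℤ) := by
    unfold Arc.width Arc.IsPending at *
    omega
  have hle : Δ.z ≤ Δ.x + (n + 1) := Δ.side_xz.snd_le
  have hx := Δ.x_lt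
  have hy := Δ.y_lt
  match k with
  | 0 => rfl
  | 1 =>
    have h : _ = Δ.z - Δ.y := h.width_eq
    omega
  | 2 =>
    have h : _ = Δ.y - Δ.x := h.width_eq
    omega

theorem exists_internalTriangle (Δ : τ.Triangle) {k : Fin 3} {α β γ : τ.Vertex}
    (hα : α.1.IsLift (Δ.side k)) (hβ : β.1.IsLift (Δ.side (k + 1)))
    (hγ : γ.1.IsLift (Δ.side (k + 1 + 1))) :
    ∃ T : τ.InternalTriangle, T.toTriangle = Δ ∧
      T.arc k = α ∧ T.arc (k + 1) = β ∧ T.arc (k + 1 + 1) = γ := by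
  have hl : ∀ k l : Fin 3, l = k ∨ l = k + 1 ∨ l = k + 1 + 1 := by decide
  have hside (l : Fin 3) : ∃ δ : τ.Vertex, δ.1.IsLift (Δ.side l) := by
    rcases hl k l with rfl | rfl | rfl
    exacts [⟨α, hα⟩, ⟨β, hβ⟩, ⟨γ, hγ⟩]
  choose arc harc using hside
  exact ⟨⟨Δ, arc, harc⟩, rfl, Subtype.ext ((harc _).unique hα), Subtype.ext ((harc _).unique hβ),
    Subtype.ext ((harc _).unique hγ)⟩

end Triangle

/-! ### The polarization of a triangulation -/

namespace Arrow

variable {α β γ : τ.Vertex}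

/-- Whether an arrow leaves its tail on the upper side of that arc in the half plane. The upper
side of the pending arc faces the orbifold point, and the loop is attached there. -/
def leavesAbove : {α β : τ.Vertex} → τ.Arrow α β → Bool
  | _, _, .inTriangle _ k _ _ => decide (k ≠ 0)
  | _, _, .loop _ _ => true

/-- Whether an arrow arrives at its head on the upper side of that arc in the half plane. -/
def arrivesAbove : {α β : τ.Vertex} → τ.Arrow α β → Bool
  | _, _, .inTriangle _ k _ _ => decide (k + 1 ≠ 0)
  | _, _, .loop _ _ => true

theorem leavesAbove_inTriangle_eq_false {Δ : τ.Triangle} {k : Fin 3}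
    {hα : α.1.IsLift (Δ.side k)} {hβ : β.1.IsLift (Δ.side (k + 1))} (hp : α.1.IsPending) :
    (inTriangle Δ k hα hβ).leavesAbove = false :=
  decide_eq_false (not_not.2 (Triangle.eq_zero_of_isPending hp hα))

theorem arrivesAbove_inTriangle_eq_false {Δ : τ.Triangle} {k : Fin 3}
    {hα : α.1.IsLift (Δ.side k)} {hβ : β.1.IsLift (Δ.side (k + 1))} (hp : β.1.IsPending) :
    (inTriangle Δ k hα hβ).arrivesAbove = false :=
  decide_eq_false (not_not.2 (Triangle.eq_zero_of_isPending hp hβ))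

theorem eq_of_leavesAbove_eq (a : τ.Arrow α β) (b : τ.Arrow α γ)
    (h : a.leavesAbove = b.leavesAbove) : (⟨β, a⟩ : Σ δ : τ.Vertex, τ.Arrow α δ) = ⟨γ, b⟩ := by
  cases a with
  | inTriangle Δ k hα hβ =>
    cases b with
    | inTriangle Δ' k' hα' hγ =>
      obtain ⟨rfl, rfl⟩ := Triangle.unique hα hα' (not_iff_not.1 (decide_eq_decide.1 h))
      obtain rfl : β = γ := Subtype.ext (hβ.unique hγ)
      rfl
    | loop _ hp => cases (leavesAbove_inTriangle_eq_false hp).symm.trans h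
  | loop _ hp =>
    cases b with
    | inTriangle => cases h.trans (leavesAbove_inTriangle_eq_false hp)
    | loop => rfl

theorem eq_of_arrivesAbove_eq (a : τ.Arrow α γ) (b : τ.Arrow β γ)
    (h : a.arrivesAbove = b.arrivesAbove) : (⟨α, a⟩ : Σ δ : τ.Vertex, τ.Arrow δ γ) = ⟨β, b⟩ := by
  cases a with
  | inTriangle Δ k hα hγ =>
    cases b with
    | inTriangle Δ' k' hβ hγ' =>
      obtain ⟨rfl, hk⟩ := Triangle.unique hγ hγ' (not_iff_not.1 (decide_eq_decide.1 h))
      obtain rfl : k = k' := add_right_cancel hk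
      obtain rfl : α = β := Subtype.ext (hα.unique hβ)
      rfl
    | loop _ hp => cases (arrivesAbove_inTriangle_eq_false hp).symm.trans h
  | loop _ hp =>
    cases b with
    | inTriangle => cases h.trans (arrivesAbove_inTriangle_eq_false hp)
    | loop => rfl

end Arrow

/-- The arrows of `Q(τ)`, with their ends labelled by the sides of the arcs on which they lie. Its
relations are the paths made of two arrows of the same triangle and the square of the loop. -/
def polarization (τ : Triangulation n) : Polarization τ.Vertex where
  tail := Arrow.leavesAbove
  head := Arrow.arrivesAbove
  tail_inj := Arrow.eq_of_leavesAbove_eq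
  head_inj := Arrow.eq_of_arrivesAbove_eq

namespace Arrow

variable {α β γ : τ.Vertex}

theorem width_lt_width_of_arrivesAbove_eq_false {a : τ.Arrow α β} (h : a.arrivesAbove = false) :
    α.1.width < β.1.width := by
  match a with
  | .inTriangle Δ k hα hβ =>
    obtain rfl : k = 2 := eq_sub_of_add_eq (of_not_not (decide_eq_false_iff_not.1 h))
    have hwα : _ = Δ.y - Δ.x := hα.width_eq
    have hwβ : _ = Δ.z - Δ.x := hβ.width_eq
    have hy := Δ.y_lt
    omega

theorem arrivesAbove_of_leavesAbove_eq_false {a : τ.Arrow α β} (h : a.leavesAbove = false) :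
    a.arrivesAbove = true := by
  match a with
  | .inTriangle Δ k hα hβ =>
    obtain rfl : k = 0 := of_not_not (decide_eq_false_iff_not.1 h)
    rfl

theorem width_lt_width_of_leavesAbove_eq_false {a : τ.Arrow α β} (h : a.leavesAbove = false) :
    β.1.width < α.1.width := by
  match a with
  | .inTriangle Δ k hα hβ =>
    obtain rfl : k = 0 := of_not_not (decide_eq_false_iff_not.1 h)
    have hwα : _ = Δ.z - Δ.x := hα.width_eq
    have hwβ : _ = Δ.z - Δ.y := hβ.width_eq
    have hx := Δ.x_lt
    omega

/-- A number that increases along the paths avoiding the relations. Such a path rotates around a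
marked point; it first visits wider and wider arcs, arriving from below, and then narrower and
narrower ones, arriving from above. -/
def rank (a : τ.Arrow α β) : ℕ :=
  if a.arrivesAbove then 2 * (n + 1) + 1 - β.1.width else β.1.width

theorem rank_lt (a : τ.Arrow α β) : a.rank < 2 * (n + 1) + 2 := by
  have h := β.1.width_le
  unfold rank
  split_ifs <;> omega

theorem rank_lt_rank {a : τ.Arrow α β} {b : τ.Arrow β γ} (h : a.arrivesAbove ≠ b.leavesAbove) :
    a.rank < b.rank := by
  have hβ := β.1.width_le
  have hγ := γ.1.width_le
  unfold rank
  cases ha : a.arrivesAbove with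
  | true =>
    have hb : b.leavesAbove = false := Bool.eq_false_iff.2 fun hb => h (ha.trans hb.symm)
    have hw := width_lt_width_of_leavesAbove_eq_false hb
    rw [arrivesAbove_of_leavesAbove_eq_false hb, if_pos rfl, if_pos rfl]
    omega
  | false =>
    cases hb : b.arrivesAbove with
    | true =>
      rw [if_neg Bool.false_ne_true, if_pos rfl]
      omega
    | false =>
      rw [if_neg Bool.false_ne_true, if_neg Bool.false_ne_true]
      exact width_lt_width_of_arrivesAbove_eq_false hb

end Arrow

theorem length_lt_of_avoids {α β : τ.Vertex} (p : Path α β)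
    (hp : Avoids τ.polarization.relations p) : p.length < 2 * (n + 1) + 3 :=
  Nat.lt_succ_of_le <| hp.length_le_of_rank_lt (rank := Arrow.rank) Arrow.rank_lt fun _ _ h =>
    Arrow.rank_lt_rank (mt τ.polarization.path₂_mem_relations.2 h)

/-! ### The potential -/

section Potential

open scoped ComplexOrder

theorem potential_apply (q : QPath τ.Vertex) : τ.potential q =
    ∑ Δ : τ.InternalTriangle, ofPath Δ.cycle q + ∑ α : τ.PendingArc, ofPath α.loopCubed q :=
  congrArg₂ (· + ·) (CompletedPathAlgebra.sum_apply ..) (CompletedPathAlgebra.sum_apply ..)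

theorem potential_nonneg (q : QPath τ.Vertex) : 0 ≤ τ.potential q := by
  rw [potential_apply]
  exact add_nonneg (Finset.sum_nonneg fun _ _ => ofPath_nonneg _ _)
    (Finset.sum_nonneg fun _ _ => ofPath_nonneg _ _)

theorem potential_cycle_ne_zero (Δ : τ.InternalTriangle) : τ.potential Δ.cycle ≠ 0 := by
  rw [potential_apply]
  exact (add_pos_of_pos_of_nonneg
    (Finset.sum_pos' (fun _ _ => ofPath_nonneg _ _)
      ⟨Δ, Finset.mem_univ Δ, (ofPath_self Δ.cycle).symm ▸ one_pos⟩)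
    (Finset.sum_nonneg fun _ _ => ofPath_nonneg _ _)).ne'

theorem potential_loopCubed_ne_zero (α : τ.PendingArc) : τ.potential α.loopCubed ≠ 0 := by
  rw [potential_apply]
  exact (add_pos_of_nonneg_of_pos
    (Finset.sum_nonneg fun _ _ => ofPath_nonneg _ _)
    (Finset.sum_pos' (fun _ _ => ofPath_nonneg _ _)
      ⟨α, Finset.mem_univ α, (ofPath_self α.loopCubed).symm ▸ one_pos⟩)).ne'

theorem eq_of_potential_ne_zero {q : QPath τ.Vertex} (h : τ.potential q ≠ 0) :
    (∃ Δ : τ.InternalTriangle, q = Δ.cycle) ∨ ∃ α : τ.PendingArc, q = α.loopCubed := by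
  by_contra! hq
  refine h ?_
  rw [potential_apply, Finset.sum_eq_zero fun Δ _ => ofPath_of_ne (hq.1 Δ),
    Finset.sum_eq_zero fun α _ => ofPath_of_ne (hq.2 α), add_zero]

theorem potential_supportedOnTriangles : τ.polarization.SupportedOnTriangles τ.potential := by
  intro q hq
  rcases eq_of_potential_ne_zero hq with ⟨Δ, rfl⟩ | ⟨α, rfl⟩
  all_goals
    refine ⟨rfl, (Cycle.chain_coe_cons ..).2 ?_⟩
    exact .cons_cons rfl (.cons_cons rfl (.cons_cons rfl (.singleton _)))

theorem InternalTriangle.exists_cyclicDerivative_ne_zero (Δ : τ.InternalTriangle) (k : Fin 3) :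
    ∃ c : Δ.arc (k + 1 + 1) ⟶ Δ.arc k,
      cyclicDerivative c τ.potential (path₂ (Δ.arrow (k + 1)) (Δ.arrow k)) ≠ 0 := by
  have h := potential_cycle_ne_zero Δ
  match k with
  | 0 => exact ⟨Δ.arrow 2, cyclicDerivative_apply_ne_zero potential_nonneg .nil
      ((Path.nil.cons (Δ.arrow 0)).cons (Δ.arrow 1)) h⟩
  | 1 => exact ⟨Δ.arrow 0, cyclicDerivative_apply_ne_zero potential_nonneg
      ((Path.nil.cons (Δ.arrow 1)).cons (Δ.arrow 2)) .nil h⟩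
  | 2 => exact ⟨Δ.arrow 1, cyclicDerivative_apply_ne_zero potential_nonneg
      (Path.nil.cons (Δ.arrow 2)) (Path.nil.cons (Δ.arrow 0)) h⟩

theorem exists_cyclicDerivative_ne_zero_of_relation {α β γ : τ.Vertex} (a : τ.Arrow α β)
    (b : τ.Arrow β γ) (hab : path₂ (V := τ.Vertex) b a ∈ τ.polarization.relations) :
    ∃ c : γ ⟶ α, cyclicDerivative c τ.potential (path₂ b a) ≠ 0 := by
  have h : Arrow.arrivesAbove a = Arrow.leavesAbove b :=
    τ.polarization.path₂_mem_relations.1 hab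
  cases a with
  | inTriangle Δ k hα hβ =>
    cases b with
    | inTriangle Δ' k' hβ' hγ =>
      obtain ⟨rfl, rfl⟩ := Triangle.unique hβ hβ' (not_iff_not.1 (decide_eq_decide.1 h))
      obtain ⟨T, rfl, rfl, rfl, rfl⟩ := Δ.exists_internalTriangle hα hβ hγ
      exact T.exists_cyclicDerivative_ne_zero k
    | loop _ hp => cases (Arrow.arrivesAbove_inTriangle_eq_false hp).symm.trans h
  | loop _ hp =>
    cases b with
    | inTriangle => cases h.trans (Arrow.leavesAbove_inTriangle_eq_false hp)
    | loop =>
      let ε := PendingArc.loop ⟨α, hp⟩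
      exact ⟨ε, cyclicDerivative_apply_ne_zero potential_nonneg .nil ((Path.nil.cons ε).cons ε)
        (potential_loopCubed_ne_zero ⟨α, hp⟩)⟩

end Potential

end Triangulation

end OrbPoly

theorem mainTheorem10 (n : ℕ) (hn : 2 ≤ n) (τ : OrbPoly.Triangulation n) :
    ∃ P : Set (OrbPoly.QPath τ.Vertex), OrbPoly.IsGentle P ∧
      ∃ φ : (OrbPoly.pathIdeal P).ringCon.Quotient ≃ₐ[ℂ] τ.Lam,
        ∀ x : OrbPoly.PathAlgebra τ.Vertex,
          φ ((OrbPoly.pathIdeal P).ringCon.mk' x) =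
            (OrbPoly.CompletedPathAlgebra.jacobianIdeal τ.potential).ringCon.mk'
              (x : OrbPoly.CompletedPathAlgebra τ.Vertex) := by
  refine ⟨τ.polarization.relations, ?_, ?_⟩
  · exact τ.polarization.isGentle OrbPoly.Triangulation.length_lt_of_avoids
  · exact OrbPoly.Triangulation.potential_supportedOnTriangles.exists_algEquiv_jacobianAlgebra
      OrbPoly.Triangulation.exists_cyclicDerivative_ne_zero_of_relation
      OrbPoly.Triangulation.length_lt_of_avoids
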